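/- Let $X$ be a homogeneous Poisson point process on $\mathbb{R}$ with intensity $\lambda>0$. For $x\in X$ and $i\ge 1$ let $d_i(x)$ be the distance from $x$ to its $i$-th nearest neighbour in $X\setminus\{x\}$. For $\underline\alpha=(\alpha_1,\alpha_2,\dots)$ with $\alpha_i\ge 0$, the generalised nearest neighbour model $\mathrm{GN}(1,\underline\alpha)$ is the undirected random graph with vertex set $X$ in which each $x\in X$ is joined by an edge to every other $y\in X$ with $|x-y|\le r(x)$, where $r(x)=\sum_{i=1}^\infty \alpha_i d_i(x)$ (so distinct $x,y$ are adjacent if and only if $|x-y|\le r(x)$ or $|x-y|\le r(y)$). Let $0<\gamma\le 1/2$. If $\alpha_i=\gamma^i$ for all $i\ge 1$, then $\mathrm{GN}(1,\underline\alpha)$ does not percolate: almost surely, every connected component of the graph is finite. More generally, the same holds for every $\underline\alpha$ with $0\le\alpha_i\le\gamma^i$ for all $i\ge 1$. -/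

import Mathlib

open MeasureTheory ProbabilityTheory
open scoped NNReal ENNReal

/-- `X` is a Poisson point process on `E` with intensity measure `ν`, as a random set of points:
for every measurable set `B` with `ν B < ∞`, the number of points of `X` in `B` is a random
variable with the Poisson distribution of mean `ν B`, and the numbers of points in finitely many
pairwise disjoint such sets are independent. -/
structure IsPoissonProcess {Ω E : Type*} [MeasurableSpace Ω] [MeasurableSpace E]
    (P : Measure Ω) (ν : Measure E) (X : Ω → Set E) : Prop where
  measurable_count : ∀ B : Set E, MeasurableSet B → ν B < ∞ →
    Measurable (fun ω => (X ω ∩ B).encard)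
  map_count : ∀ B : Set E, MeasurableSet B → ν B < ∞ →
    P.map (fun ω => (X ω ∩ B).encard) =
      (poissonMeasure (ν B).toNNReal).map (fun n : ℕ => (n : ℕ∞))
  indep_count : ∀ (n : ℕ) (B : Fin n → Set E), (∀ i, MeasurableSet (B i)) →
    (∀ i, ν (B i) < ∞) → (∀ i j, i ≠ j → Disjoint (B i) (B j)) →
    iIndepFun (fun i ω => (X ω ∩ B i).encard) P

namespace GNModel

variable {E : Type*} [MetricSpace E]

/-- `d_i(x)`: the distance from `x` to its `i`-th nearest neighbour in `S`, i.e. the smallest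
radius within which there are at least `i` points of `S` other than `x`
(it is `∞` if there are fewer than `i` such points). -/
noncomputable def nnDist (S : Set E) (x : E) (i : ℕ) : ℝ≥0∞ :=
  sInf {ρ : ℝ≥0∞ | (i : ℕ∞) ≤ {y ∈ S | y ≠ x ∧ edist x y ≤ ρ}.encard}

/-- The connection range `r(x) = ∑_{i ≥ 1} α_i d_i(x)`. -/
noncomputable def range (α : ℕ+ → ℝ≥0) (S : Set E) (x : E) : ℝ≥0∞ :=
  ∑' i : ℕ+, (α i : ℝ≥0∞) * nnDist S x i

/-- The generalised nearest neighbour graph on the points of `S`: each `x` is joined by an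
(undirected) edge to every other point `y` with `|x - y| ≤ r(x)`. -/
def graph (α : ℕ+ → ℝ≥0) (S : Set E) : SimpleGraph S :=
  SimpleGraph.fromRel (fun x y : S => edist (x : E) (y : E) ≤ range α S (x : E))

/-- The event that the graph has an infinite cluster. -/
def HasInfiniteCluster (α : ℕ+ → ℝ≥0) (S : Set E) : Prop :=
  ∃ c : (graph α S).ConnectedComponent, c.supp.Infinite

end GNModel

/-! Cut the line into unit cells. The occupation indicators of the cells are i.i.d. with mean `q =
9δ > 0`, and each vanishes with positive probability. The graph is disconnected at a long run of
empty cells as soon as the occupied cells on both sides have density close to `q`, uniformly at all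
scales. Indeed, a point `m` cells away from the gap finds its neighbours by looking away from the
gap, so `d_i` is at most linear in `i` plus a small multiple of `m`. Summing against `2^{-i}` gives
a range of at most `m / 2` plus a constant. The distance across the gap exceeds `m + L`, so a gap
longer than that constant cannot be bridged from either side (`isCut_of_goodGap`).

Such gaps occur arbitrarily far out (`ae_exists_goodGap`). The strong law gives a constant `C` for
which the density bounds hold with positive probability, and independence adds the empty run.
Truncated versions of the event in disjoint windows are independent, so infinitely many occur, and
the strong law from the origin removes the truncation. Cuts far out on both sides then trap every
cluster in a bounded interval, which holds finitely many points. -/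

/-! ### Deviation bounds for i.i.d. sequences -/

/-- The partial sums of `z - q` up to time `N` stay within `δ n + C` of zero. -/
def DeviationBound (q δ C : ℝ) (z : ℕ → ℝ) (N : ℕ) : Prop :=
  ∀ n ≤ N, |∑ k ∈ Finset.range n, (z k - q)| ≤ δ * n + C

lemma measurableSet_deviationBound {Ω : Type*} [MeasurableSpace Ω] {z : ℕ → Ω → ℝ}
    (q δ C : ℝ) (N : ℕ) (hz : ∀ k < N, Measurable (z k)) :
    MeasurableSet {ω | DeviationBound q δ C (fun k => z k ω) N} := by
  have : {ω | DeviationBound q δ C (fun k => z k ω) N} =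
      ⋂ n : ℕ, ⋂ _ : n ≤ N, {ω | |∑ k ∈ Finset.range n, (z k ω - q)| ≤ δ * n + C} := by
    ext ω; simp [DeviationBound]
  rw [this]
  refine MeasurableSet.iInter fun n => MeasurableSet.iInter fun hn => ?_
  have hm : Measurable fun ω => ∑ k ∈ Finset.range n, (z k ω - q) :=
    Finset.measurable_fun_sum _ fun k hk =>
      (hz k ((Finset.mem_range.1 hk).trans_le hn)).sub_const q
  exact measurableSet_le (continuous_abs.measurable.comp hm) measurable_const

lemma iIndepSet_of_measurableSet_iSup {Ω ι : Type*} {m0 : MeasurableSpace Ω} {μ : Measure Ω}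
    [IsProbabilityMeasure μ] {m : ι → MeasurableSpace Ω} (hle : ∀ i, m i ≤ m0) (hm : iIndep m μ)
    {T : ℕ → Set ι} (hT : Pairwise fun a b => Disjoint (T a) (T b)) {G : ℕ → Set Ω}
    (hG : ∀ n, MeasurableSet[⨆ i ∈ T n, m i] (G n)) : iIndepSet G μ := by
  have hG0 : ∀ n, MeasurableSet (G n) := fun n => iSup₂_le (fun i _ => hle i) _ (hG n)
  rw [iIndepSet_iff_meas_biInter hG0]
  intro s
  induction s using Finset.induction_on with
  | empty => simp
  | insert a s ha ih =>
    rw [Finset.set_biInter_insert, Finset.prod_insert ha, ← ih]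
    have hd : Disjoint (T a) (⋃ b ∈ s, T b) := by
      rw [Set.disjoint_iUnion₂_right]
      intro b hb
      exact hT (fun h => ha (h ▸ hb))
    have := indep_iSup_of_disjoint hle hm hd
    refine (Indep_iff _ _ _).1 this _ _ (hG a) ?_
    refine Finset.measurableSet_biInter s fun b hb => ?_
    have hsub : T b ⊆ ⋃ b ∈ s, T b := Set.subset_biUnion_of_mem (u := T) hb
    exact biSup_mono (f := m) (fun i hi => hsub hi) _ (hG b)

section IID

variable {Ω : Type*} [MeasurableSpace Ω] {P : Measure Ω} {Z : ℤ → Ω → ℝ}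

lemma ae_exists_deviationBound (hind : iIndepFun Z P)
    (hid : ∀ j, IdentDistrib (Z j) (Z 0) P P) (hint : Integrable (Z 0) P)
    {e : ℕ → ℤ} (he : e.Injective) {δ : ℝ} (hδ : 0 < δ) :
    ∀ᵐ ω ∂P, ∃ C : ℕ, ∀ N, DeviationBound (∫ ω, Z 0 ω ∂P) δ C (fun k => Z (e k) ω) N := by
  have h0 : ∀ i, IdentDistrib (Z (e i)) (Z (e 0)) P P := fun i => (hid _).trans (hid _).symm
  have hs := strong_law_ae_real (μ := P) (fun k => Z (e k))
    ((hid (e 0)).integrable_iff.2 hint)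
    (fun i j hij => hind.indepFun (he.ne hij)) h0
  filter_upwards [hs] with ω hω
  rw [(hid (e 0)).integral_eq] at hω
  set q := ∫ ω, Z 0 ω ∂P
  have hev := (Metric.tendsto_atTop.1 hω) δ hδ
  obtain ⟨M, hM⟩ := hev
  set f : ℕ → ℝ := fun n => |∑ k ∈ Finset.range n, (Z (e k) ω - q)|
  -- `C` absorbs the finitely many partial sums before the strong law takes effect.
  obtain ⟨C, hC⟩ := exists_nat_ge (∑ n ∈ Finset.range M, f n)
  refine ⟨C, fun N n _ => ?_⟩
  rcases lt_or_ge n M with hn | hn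
  · have : f n ≤ ∑ n ∈ Finset.range M, f n :=
      Finset.single_le_sum (f := f) (fun i _ => abs_nonneg _) (Finset.mem_range.2 hn)
    have : 0 ≤ δ * n := by positivity
    change f n ≤ _
    linarith
  · rcases Nat.eq_zero_or_pos n with rfl | hpos
    · simp
    have h1 := hM n hn
    rw [Real.dist_eq] at h1
    have hn' : (0 : ℝ) < n := by exact_mod_cast hpos
    have h2 : ∑ k ∈ Finset.range n, (Z (e k) ω - q)
        = ((∑ k ∈ Finset.range n, Z (e k) ω) / n - q) * n := by
      rw [Finset.sum_sub_distrib]; simp; field_simp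
    rw [h2, abs_mul, abs_of_pos hn']
    have : (0 : ℝ) ≤ C := by positivity
    nlinarith

/-- Along any injective enumeration the variables have the same product law, so one probability
serves every starting point and both directions. -/
lemma measure_deviationBound_eq (hmeas : ∀ j, Measurable (Z j)) (hind : iIndepFun Z P)
    (hid : ∀ j, IdentDistrib (Z j) (Z 0) P P) {e e' : ℕ → ℤ} (he : e.Injective)
    (he' : e'.Injective) (q δ C : ℝ) :
    P {ω | ∀ N, DeviationBound q δ C (fun k => Z (e k) ω) N} =
      P {ω | ∀ N, DeviationBound q δ C (fun k => Z (e' k) ω) N} := by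
  have hlaw : P.map (fun ω k => Z (e k) ω) = P.map (fun ω k => Z (e' k) ω) := by
    rw [(hind.precomp he).map_fun_eq_infinitePi_map (fun i => hmeas _),
      (hind.precomp he').map_fun_eq_infinitePi_map (fun i => hmeas _)]
    congr 1
    funext i
    exact ((hid (e i)).trans (hid (e' i)).symm).map_eq
  have hS : MeasurableSet {z : ℕ → ℝ | ∀ N, DeviationBound q δ C z N} := by
    rw [Set.ofPred_forall]
    exact MeasurableSet.iInter fun N =>
      measurableSet_deviationBound (z := fun k (z : ℕ → ℝ) => z k) q δ C N
        fun k _ => measurable_pi_apply k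
  have h1 := Measure.map_apply (μ := P) (f := fun ω k => Z (e k) ω)
    (measurable_pi_lambda _ fun k => hmeas _) hS
  have h2 := Measure.map_apply (μ := P) (f := fun ω k => Z (e' k) ω)
    (measurable_pi_lambda _ fun k => hmeas _) hS
  rw [hlaw] at h1
  exact h1.symm.trans h2

/-- The events for `C = 0, 1, 2, …` cover almost all of the space, so they cannot all be null. -/
lemma exists_pos_measure_deviationBound [IsProbabilityMeasure P] (hmeas : ∀ j, Measurable (Z j))
    (hind : iIndepFun Z P) (hid : ∀ j, IdentDistrib (Z j) (Z 0) P P) (hint : Integrable (Z 0) P) {δ : ℝ} (hδ : 0 < δ) :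
    ∃ C : ℕ, ∃ p : ℝ≥0∞, 0 < p ∧ ∀ e : ℕ → ℤ, e.Injective →
      P {ω | ∀ N, DeviationBound (∫ ω, Z 0 ω ∂P) δ C (fun k => Z (e k) ω) N} = p := by
  have hinj : Function.Injective (fun k : ℕ => (k : ℤ)) := Nat.cast_injective
  have h := ae_exists_deviationBound hind hid hint hinj hδ
  by_contra! hcon
  have hz : ∀ C : ℕ,
      P {ω | ∀ N, DeviationBound (∫ ω, Z 0 ω ∂P) δ C (fun k => Z (k : ℕ) ω) N} = 0 := by
    intro C
    by_contra hne
    obtain ⟨e, he, hne'⟩ := hcon C _ (pos_iff_ne_zero.2 hne)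
    exact hne' (measure_deviationBound_eq hmeas hind hid he hinj _ _ _)
  have hall : ∀ᵐ ω ∂P, ∀ C : ℕ,
      ¬ ∀ N, DeviationBound (∫ ω, Z 0 ω ∂P) δ C (fun k => Z (k : ℕ) ω) N := by
    rw [ae_all_iff]
    intro C
    rw [ae_iff]
    simpa using hz C
  have : ∀ᵐ ω ∂P, False := by
    filter_upwards [h, hall] with ω h1 h2
    obtain ⟨C, hC⟩ := h1
    exact h2 C hC
  exact IsProbabilityMeasure.ne_zero P (by simpa using this)

end IID

/-! ### Gaps with regular density on both sides -/

/-- The cells `c, …, c + L - 1` are empty, and the occupation of the cells on both sides of this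
gap has density close to `q`, up to the range `N`. -/
def GoodGap (q δ C : ℝ) (z : ℤ → ℝ) (c : ℤ) (L N : ℕ) : Prop :=
  DeviationBound q δ C (fun k => z (c - 1 - k)) N ∧
    (∀ k < L, z (c + k) = 0) ∧ DeviationBound q δ C (fun k => z (c + L + k)) N

/-- Transfers gaps far to the right of the reflected configuration to gaps far to the left of the
original one. -/
lemma GoodGap.reflect {q δ C : ℝ} {z : ℤ → ℝ} {c : ℤ} {L N : ℕ}
    (h : GoodGap q δ C (fun j => z (-1 - j)) c L N) : GoodGap q δ C z (-c - L) L N := by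
  refine ⟨?_, fun k hk => ?_, ?_⟩
  · convert h.2.2 using 3
    ring
  · have : z (-1 - (c + ((L - 1 - k : ℕ) : ℤ))) = 0 := h.2.1 (L - 1 - k) (by omega)
    rwa [show -1 - (c + ((L - 1 - k : ℕ) : ℤ)) = -c - L + k by omega] at this
  · convert h.1 using 3
    ring

lemma sum_range_left (z : ℤ → ℝ) (c n : ℕ) (hn : n ≤ c) :
    ∑ k ∈ Finset.range n, z ((c : ℤ) - 1 - k) =
      ∑ k ∈ Finset.range c, z k - ∑ k ∈ Finset.range (c - n), z k := by
  induction n with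
  | zero => simp
  | succ n ih =>
    rw [Finset.sum_range_succ, ih (by omega)]
    have : c - n = (c - (n + 1)) + 1 := by omega
    rw [this, Finset.sum_range_succ]
    have : ((c - (n + 1) : ℕ) : ℤ) = (c : ℤ) - 1 - n := by omega
    rw [this]; ring

lemma sum_range_left_add (z : ℤ → ℝ) (c r : ℕ) :
    ∑ k ∈ Finset.range (c + r), z ((c : ℤ) - 1 - k) =
      ∑ k ∈ Finset.range c, z k + ∑ k ∈ Finset.range r, z (-1 - k) := by
  induction r with
  | zero => simp [sum_range_left z c c le_rfl]
  | succ r ih =>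
    rw [← add_assoc, Finset.sum_range_succ, ih, Finset.sum_range_succ]
    have : (c : ℤ) - 1 - ((c + r : ℕ) : ℤ) = -1 - r := by push_cast; ring
    rw [this]; ring

lemma sum_range_right (z : ℤ → ℝ) (c n : ℕ) :
    ∑ k ∈ Finset.range n, z ((c : ℤ) + k) =
      ∑ k ∈ Finset.range (c + n), z k - ∑ k ∈ Finset.range c, z k := by
  rw [Finset.sum_range_add]; push_cast; ring

/-- Beyond range `N`, a sum starting at the gap is a combination of two sums starting at the origin.
With `L ≤ N ≤ i` their lengths total at most `7 i`, costing `δ i / 2` at rate `δ / 14`; the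
remaining `2 C₀ ≤ δ N / 2` uses up the other half of `δ i`. -/
lemma GoodGap.of_deviationBound {q δ C : ℝ} {z : ℤ → ℝ} {L N : ℕ} (hδ : 0 < δ) {C₀ : ℝ}
    (hC : 0 ≤ C) (hr : ∀ n, DeviationBound q (δ / 14) C₀ (fun k => z k) n)
    (hl : ∀ n, DeviationBound q (δ / 14) C₀ (fun k => z (-1 - k)) n)
    (hLN : L ≤ N) (hN : 4 * C₀ ≤ δ * N) (h : GoodGap q δ C z ((2 * N : ℕ) : ℤ) L N) (n : ℕ) :
    GoodGap q δ C z ((2 * N : ℕ) : ℤ) L n := by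
  have hr' : ∀ n : ℕ, |∑ k ∈ Finset.range n, (z k - q)| ≤ δ / 14 * n + C₀ :=
    fun n => hr n n le_rfl
  have hl' : ∀ n : ℕ, |∑ k ∈ Finset.range n, (z (-1 - k) - q)| ≤ δ / 14 * n + C₀ :=
    fun n => hl n n le_rfl
  refine ⟨fun i _ => ?_, h.2.1, fun i _ => ?_⟩
  · rcases le_total i N with hi | hi
    · exact h.1 i hi
    have hiR : (N : ℝ) ≤ i := by exact_mod_cast hi
    have h1 := abs_le.1 (hr' (2 * N))
    rcases le_total i (2 * N) with hi2 | hi2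
    · rw [sum_range_left (fun j => z j - q) (2 * N) i hi2]
      have h2 := abs_le.1 (hr' (2 * N - i))
      push_cast [Nat.cast_sub hi2] at h1 h2
      rw [abs_le]
      constructor <;> nlinarith
    · obtain ⟨r, rfl⟩ := Nat.exists_eq_add_of_le hi2
      rw [sum_range_left_add (fun j => z j - q) (2 * N) r]
      have h2 := abs_le.1 (hl' r)
      push_cast at h1 h2 hiR ⊢
      have hrr : (0 : ℝ) ≤ δ * r := by positivity
      have hNN : (0 : ℝ) ≤ δ * N := by positivity
      rw [abs_le]
      constructor <;> nlinarith
  · rcases le_total i N with hi | hi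
    · exact h.2.2 i hi
    have hiR : (N : ℝ) ≤ i := by exact_mod_cast hi
    have hLR : (L : ℝ) ≤ N := by exact_mod_cast hLN
    have h3 : ((2 * N : ℕ) : ℤ) + (L : ℤ) = ((2 * N + L : ℕ) : ℤ) := by push_cast; ring
    simp only [h3]
    rw [sum_range_right (fun j => z j - q) (2 * N + L) i]
    have h1 := abs_le.1 (hr' (2 * N + L))
    have h2 := abs_le.1 (hr' (2 * N + L + i))
    push_cast at h1 h2
    have e1 : δ * N ≤ δ * i := by gcongr
    have e2 : δ * L ≤ δ * N := by gcongr
    rw [abs_le]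
    constructor <;> nlinarith

lemma measurableSet_goodGap {Ω : Type*} [MeasurableSpace Ω] {Z : ℤ → Ω → ℝ} (q δ C : ℝ) (c : ℤ)
    (L N : ℕ) (hZ : ∀ j ∈ Set.Ico (c - N) (c + L + N), Measurable (Z j)) :
    MeasurableSet {ω | GoodGap q δ C (fun j => Z j ω) c L N} := by
  refine (measurableSet_deviationBound (z := fun k => Z (c - 1 - k)) q δ C N
    fun k hk => hZ _ ⟨by omega, by omega⟩).inter (MeasurableSet.inter ?_
      (measurableSet_deviationBound (z := fun k => Z (c + L + k)) q δ C N
    fun k hk => hZ _ ⟨by omega, by omega⟩))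
  change MeasurableSet {ω | ∀ k < L, Z (c + k) ω = 0}
  rw [Set.ofPred_forall]
  refine MeasurableSet.iInter fun k => ?_
  rw [Set.ofPred_forall]
  exact MeasurableSet.iInter fun hk =>
    (hZ _ ⟨by omega, by omega⟩) (measurableSet_singleton (0 : ℝ))

/-- The `σ`-algebra generated by the variables `Z j`, `j ∈ T`. -/
abbrev sigmaOn {Ω : Type*} (Z : ℤ → Ω → ℝ) (T : Set ℤ) : MeasurableSpace Ω :=
  ⨆ j ∈ T, MeasurableSpace.comap (Z j) inferInstance

lemma measurable_sigmaOn {Ω : Type*} {Z : ℤ → Ω → ℝ} {T : Set ℤ} {j : ℤ} (hj : j ∈ T) :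
    Measurable[sigmaOn Z T] (Z j) :=
  measurable_iff_comap_le.2
    (le_iSup₂_of_le (f := fun j (_ : j ∈ T) => MeasurableSpace.comap (Z j) inferInstance) j hj le_rfl)

/-! ### Good gaps occur arbitrarily far out -/

section GoodGapProbability

variable {Ω : Type*} [MeasurableSpace Ω] {P : Measure Ω} {Z : ℤ → Ω → ℝ}

/-- The left side, the gap and the right side involve disjoint sets of cells, so the probabilities
multiply. The bound is uniform in `c` and `N`, as a Borel–Cantelli argument needs. -/
lemma pos_measure_goodGap (hmeas : ∀ j, Measurable (Z j)) (hind : iIndepFun Z P)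
    (hid : ∀ j, IdentDistrib (Z j) (Z 0) P P) (h0 : 0 < P {ω | Z 0 ω = 0}) {q δ C : ℝ}
    {p : ℝ≥0∞} (hp : 0 < p) (hP : ∀ e : ℕ → ℤ, e.Injective →
      P {ω | ∀ N, DeviationBound q δ C (fun k => Z (e k) ω) N} = p) (L : ℕ) :
    ∃ p' > 0, ∀ (c : ℤ) (N : ℕ), p' ≤ P {ω | GoodGap q δ C (fun j => Z j ω) c L N} := by
  refine ⟨p * (P {ω | Z 0 ω = 0} ^ L * p), by positivity, fun c N => ?_⟩
  set A := {ω | ∀ N, DeviationBound q δ C (fun k => Z (c - 1 - k) ω) N} with hA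
  set B := {ω | ∀ k < L, Z (c + k) ω = 0} with hB
  set D := {ω | ∀ N, DeviationBound q δ C (fun k => Z (c + L + k) ω) N} with hD
  have hle : ∀ j, MeasurableSpace.comap (Z j) inferInstance ≤ (inferInstance : MeasurableSpace Ω) :=
    fun j => (hmeas j).comap_le
  have hPA : P A = p := hP (fun k => c - 1 - k) fun a b h => by simpa using h
  have hPD : P D = p := hP (fun k => c + L + k) fun a b h => by simpa using h
  have hPB : P B = P {ω | Z 0 ω = 0} ^ L := by
    have hi : iIndepFun (fun k : ℕ => Z (c + k)) P :=
      hind.precomp (g := fun k : ℕ => c + (k : ℤ)) fun a b h => by simpa using h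
    have := hi.measure_inter_preimage_eq_mul (Finset.range L) (sets := fun _ => {0})
      fun _ _ => measurableSet_singleton _
    have h2 : B = ⋂ i ∈ Finset.range L, Z (c + i) ⁻¹' {0} := by
      ext ω; simp [hB]
    rw [h2, this, Finset.prod_congr rfl (g := fun _ => P {ω | Z 0 ω = 0}), Finset.prod_const,
      Finset.card_range]
    intro k _
    exact (hid (c + k)).measure_mem_eq (measurableSet_singleton _)
  have mA : MeasurableSet[sigmaOn Z (Set.Iio c)] A := by
    rw [hA, Set.ofPred_forall]
    exact MeasurableSet.iInter fun N => @measurableSet_deviationBound _ (sigmaOn Z _)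
      (fun k => Z (c - 1 - k)) q δ C N fun k _ => measurable_sigmaOn (by simp; omega)
  have mD : MeasurableSet[sigmaOn Z (Set.Ici (c + L))] D := by
    rw [hD, Set.ofPred_forall]
    exact MeasurableSet.iInter fun N => @measurableSet_deviationBound _ (sigmaOn Z _)
      (fun k => Z (c + L + k)) q δ C N fun k _ => measurable_sigmaOn (by simp)
  have mB : ∀ T, Set.Ico c (c + L) ⊆ T → MeasurableSet[sigmaOn Z T] B := by
    intro T hT
    rw [hB, Set.ofPred_forall]
    refine MeasurableSet.iInter fun k => ?_
    rw [Set.ofPred_forall]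
    exact MeasurableSet.iInter fun hk =>
      measurable_sigmaOn (hT ⟨by omega, by omega⟩) (measurableSet_singleton (0 : ℝ))
  have hBD : P (B ∩ D) = P B * P D := by
    refine (Indep_iff _ _ _).1 (indep_iSup_of_disjoint hle hind.iIndep
      (S := Set.Ico c (c + L)) (T := Set.Ici (c + L)) ?_) _ _ (mB _ subset_rfl) mD
    exact Set.disjoint_left.2 fun x h1 h2 => absurd h1.2 (not_lt.2 h2)
  have hABD : P (A ∩ (B ∩ D)) = P A * P (B ∩ D) := by
    refine (Indep_iff _ _ _).1 (indep_iSup_of_disjoint hle hind.iIndep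
      (S := Set.Iio c) (T := Set.Ici c) ?_) _ _ mA ?_
    · exact Set.disjoint_left.2 fun x h1 h2 => absurd (Set.mem_Iio.1 h1) (not_lt.2 h2)
    · refine MeasurableSet.inter (mB _ fun x hx => hx.1) ?_
      have : Set.Ici (c + (L : ℤ)) ⊆ Set.Ici c := Set.Ici_subset_Ici.2 (by omega)
      exact (biSup_mono fun i hi => this hi :
        sigmaOn Z (Set.Ici (c + L)) ≤ sigmaOn Z (Set.Ici c)) _ mD
  rw [hBD, hPA, hPB, hPD] at hABD
  rw [← hABD]
  exact measure_mono fun ω hω => ⟨hω.1 N, hω.2.1, hω.2.2 N⟩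

/-- An i.i.d. sequence of variables which vanish with positive probability almost surely has, at
arbitrarily large positions, long gaps with regular density on both sides. -/
theorem ae_exists_goodGap [IsProbabilityMeasure P] (hmeas : ∀ j, Measurable (Z j))
    (hind : iIndepFun Z P) (hid : ∀ j, IdentDistrib (Z j) (Z 0) P P)
    (hint : Integrable (Z 0) P) (h0 : 0 < P {ω | Z 0 ω = 0}) {δ : ℝ} (hδ : 0 < δ) :
    ∃ C : ℝ, 0 ≤ C ∧ ∀ L : ℕ, ∀ᵐ ω ∂P, ∀ K : ℕ, ∃ c : ℤ, (K : ℤ) ≤ c ∧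
      ∀ N, GoodGap (∫ ω, Z 0 ω ∂P) δ C (fun j => Z j ω) c L N := by
  obtain ⟨C, p, hp, hP⟩ := exists_pos_measure_deviationBound hmeas hind hid hint hδ
  refine ⟨C, Nat.cast_nonneg C, fun L => ?_⟩
  obtain ⟨p', hp', hG⟩ := pos_measure_goodGap hmeas hind hid h0 hp hP L
  set q := ∫ ω, Z 0 ω ∂P
  -- The event at scale `N` sees only the cells in `[N, 3N + L)`. Since `L < N` and the scales grow
  -- by a factor 4, these windows are disjoint.
  let N : ℕ → ℕ := fun m => (L + 1) * 4 ^ m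
  have hNL : ∀ m, L + 1 ≤ N m := fun m => Nat.le_mul_of_pos_right _ (by positivity)
  have hNm : ∀ m, m ≤ N m := fun m =>
    (Nat.lt_pow_self (by norm_num : 1 < 4)).le.trans (Nat.le_mul_of_pos_left _ (by omega))
  have hNmono : ∀ a b, a < b → 4 * N a ≤ N b := fun a b hab => by
    have : 4 ^ (a + 1) ≤ 4 ^ b := Nat.pow_le_pow_right (by norm_num) hab
    calc 4 * N a = (L + 1) * 4 ^ (a + 1) := by simp only [N]; ring
      _ ≤ _ := Nat.mul_le_mul_left _ this
  let G : ℕ → Set Ω := fun m =>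
    {ω | GoodGap q δ C (fun j => Z j ω) ((2 * N m : ℕ) : ℤ) L (N m)}
  let T : ℕ → Set ℤ := fun m =>
    Set.Ico (((2 * N m : ℕ) : ℤ) - N m) (((2 * N m : ℕ) : ℤ) + L + N m)
  have hT : ∀ a b, a < b → Disjoint (T a) (T b) := fun a b hab => by
    refine Set.disjoint_left.2 fun x h1 h2 => ?_
    have := hNmono a b hab
    have := hNL a
    have h3 := h1.2
    have h4 := h2.1
    push_cast at h3 h4
    omega
  have hGm : ∀ m, MeasurableSet[sigmaOn Z (T m)] (G m) := fun m =>
    @measurableSet_goodGap _ (sigmaOn Z (T m)) Z q δ C _ L (N m)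
      fun j hj => measurable_sigmaOn hj
  have hGi : iIndepSet G P := by
    refine iIndepSet_of_measurableSet_iSup (fun j => (hmeas j).comap_le) hind.iIndep
      (T := T) (fun a b hab => ?_) hGm
    rcases lt_or_gt_of_ne hab with h | h
    · exact hT a b h
    · exact (hT b a h).symm
  have hG0 : ∀ m, MeasurableSet (G m) := fun m =>
    measurableSet_goodGap q δ C _ L (N m) fun j _ => hmeas j
  have hsum : ∑' m, P (G m) = ∞ := by
    refine top_unique ?_
    rw [← ENNReal.tsum_const_eq_top_of_ne_zero (α := ℕ) hp'.ne']
    exact ENNReal.tsum_le_tsum fun m => hG _ _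
  -- Second Borel–Cantelli lemma.
  have hlim := measure_limsup_eq_one hG0 hGi hsum
  have hae : ∀ᵐ ω ∂P, ω ∈ Filter.limsup G Filter.atTop :=
    (prob_compl_eq_zero_iff (MeasurableSet.measurableSet_limsup hG0)).2 hlim
  have hr := ae_exists_deviationBound hind hid hint (e := fun k => (k : ℤ))
    Nat.cast_injective (by positivity : 0 < δ / 14)
  have hl := ae_exists_deviationBound hind hid hint (e := fun k => -1 - (k : ℤ))
    (fun a b h => by simpa using h) (by positivity : 0 < δ / 14)
  filter_upwards [hae, hr, hl] with ω h1 ⟨C₁, h2⟩ ⟨C₂, h3⟩ K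
  rw [Filter.mem_limsup_iff_frequently_mem, Filter.frequently_atTop] at h1
  obtain ⟨M, hM⟩ := exists_nat_ge (4 * (max (C₁ : ℝ) C₂) / δ)
  obtain ⟨m, hm, hmG⟩ := h1 (max M K)
  have hgood : GoodGap q δ C (fun j => Z j ω) ((2 * N m : ℕ) : ℤ) L (N m) := hmG
  refine ⟨((2 * N m : ℕ) : ℤ), ?_, fun n => GoodGap.of_deviationBound (C₀ := max (C₁ : ℝ) C₂) hδ
    (Nat.cast_nonneg C) (fun n i hi => (h2 n i hi).trans ?_) (fun n i hi => (h3 n i hi).trans ?_)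
    ?_ ?_ hgood n⟩
  · have := hNm m
    have := le_max_right M K
    omega
  · gcongr; exact le_max_left _ _
  · gcongr; exact le_max_right _ _
  · have := hNL m; omega
  · have h5 : (M : ℝ) ≤ N m := by
      exact_mod_cast (le_max_left M K).trans (hm.trans (hNm m))
    have := hM.trans h5
    rwa [div_le_iff₀' hδ] at this

end GoodGapProbability

/-! ### From good gaps to cuts of the graph -/

namespace GNModel

/-- `cellIndicator S j` is `1` if `S` meets `[j, j + 1)`, and `0` otherwise. -/
noncomputable def cellIndicator (S : Set ℝ) : ℤ → ℝ := (Int.floor '' S).indicator 1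

/-- Only one point per occupied cell is counted, which is enough for an upper bound on `nnDist`. -/
lemma nnDist_le_of_finset {S : Set ℝ} {x : ℝ} {i : ℕ} {ρ : ℝ≥0∞} (J : Finset ℤ)
    (hi : i ≤ J.card) (hJ : ∀ j ∈ J, ∃ y ∈ S, ⌊y⌋ = j ∧ y ≠ x ∧ edist x y ≤ ρ) :
    nnDist S x i ≤ ρ := by
  refine sInf_le ?_
  have hsub : (J : Set ℤ) ⊆ Int.floor '' {y ∈ S | y ≠ x ∧ edist x y ≤ ρ} := by
    intro j hj
    obtain ⟨y, hy, hyj, hyx⟩ := hJ j hj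
    exact ⟨y, ⟨hy, hyx⟩, hyj⟩
  calc (i : ℕ∞) ≤ (J.card : ℕ∞) := by exact_mod_cast hi
    _ = (J : Set ℤ).encard := (Set.encard_coe_eq_coe_finsetCard J).symm
    _ ≤ _ := Set.encard_le_encard hsub
    _ ≤ _ := Set.encard_image_le _ _

lemma range_le_of_nnDist_le {E : Type*} [MetricSpace E] {α : ℕ+ → ℝ≥0}
    (hα : ∀ i : ℕ+, α i ≤ (1 / 2) ^ (i : ℕ)) {S : Set E} {x : E} {A B : ℝ} (hA : 0 ≤ A)
    (hB : 0 ≤ B) (h : ∀ i : ℕ, nnDist S x i ≤ ENNReal.ofReal (A * i + B)) :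
    range α S x ≤ ENNReal.ofReal (2 * A + 2 * B) := by
  have hsum : HasSum (fun i : ℕ => (1 / 2 : ℝ) ^ i * (A * i + B)) (2 * A + 2 * B) := by
    have h1 : HasSum (fun n : ℕ => (n : ℝ) * (1 / 2) ^ n) 2 := by
      have h := hasSum_coe_mul_geometric_of_norm_lt_one (𝕜 := ℝ) (r := 1 / 2) (by norm_num)
      rwa [show (1 / 2 : ℝ) / (1 - 1 / 2) ^ 2 = 2 by norm_num] at h
    have h2 := hasSum_geometric_two
    have := (h1.mul_left A).add (h2.mul_left B)
    rw [mul_comm A, mul_comm B] at this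
    have hf : (fun i : ℕ => (1 / 2 : ℝ) ^ i * (A * i + B)) =
        fun i : ℕ => A * (i * (1 / 2) ^ i) + B * (1 / 2) ^ i := by funext i; ring
    rwa [hf]
  have hnn : ∀ i : ℕ, 0 ≤ (1 / 2 : ℝ) ^ i * (A * i + B) := fun i => by positivity
  calc range α S x
      ≤ ∑' i : ℕ+, ENNReal.ofReal ((1 / 2 : ℝ) ^ (i : ℕ) * (A * (i : ℕ) + B)) := by
        refine ENNReal.tsum_le_tsum fun i => ?_
        rw [ENNReal.ofReal_mul (by positivity)]
        refine mul_le_mul' ?_ (h i)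
        rw [← ENNReal.ofReal_coe_nnreal]
        refine ENNReal.ofReal_le_ofReal ?_
        have := hα i
        exact_mod_cast this
    _ ≤ ∑' i : ℕ, ENNReal.ofReal ((1 / 2 : ℝ) ^ i * (A * i + B)) :=
        ENNReal.tsum_comp_le_tsum_of_injective PNat.coe_injective _
    _ = _ := by rw [← ENNReal.ofReal_tsum_of_nonneg hnn hsum.summable, hsum.tsum_eq]

/-- If the cells visited from `⌊x⌋ = e m` on along a path `e` of unit steps have regular density,
then the connection range of `x` grows at most like `m / 2`. -/
lemma range_le_of_deviationBound {α : ℕ+ → ℝ≥0} (hα : ∀ i : ℕ+, α i ≤ (1 / 2) ^ (i : ℕ))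
    {S : Set ℝ} {x : ℝ} {e : ℕ → ℤ} {m : ℕ} {δ C : ℝ} (hδ : 0 < δ) (hC : 0 ≤ C)
    (he : e.Injective) (hem : ⌊x⌋ = e m) (hdist : ∀ k, |e m - e (m + k)| ≤ k)
    (hdev : ∀ N, DeviationBound (9 * δ) δ C (fun k => cellIndicator S (e k)) N) :
    range α S x ≤ ENNReal.ofReal ((m + 1) / 2 + (1 + 2 * C) / (4 * δ) + 4) := by
  classical
  -- `b` collects the deviation errors at `m + 1` and at `m + 1 + n`. Their difference counts the
  -- cells strictly beyond that of `x`, and leaves the density `9δ - δ = 8δ`.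
  set b : ℝ := 2 * δ * (m + 1) + 2 * C with hb
  have hb0 : 0 ≤ b := by positivity
  have hcount : ∀ n : ℕ,
      8 * δ * n - b ≤ ∑ k ∈ Finset.range n, cellIndicator S (e (m + 1 + k)) := by
    intro n
    have h1 := abs_le.1 (hdev _ (m + 1) le_rfl)
    have h2 := abs_le.1 (hdev _ (m + 1 + n) le_rfl)
    rw [Finset.sum_sub_distrib] at h1 h2
    rw [Finset.sum_range_add] at h2
    simp only [Finset.sum_const, Finset.card_range, nsmul_eq_mul] at h1 h2
    push_cast at h1 h2
    rw [hb]
    nlinarith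
  have hnn : ∀ i : ℕ, nnDist S x i ≤
      ENNReal.ofReal (1 / (8 * δ) * i + (b / (8 * δ) + 2)) := by
    intro i
    -- This many cells beyond `x` contain at least `i` occupied ones. The extra 2 in the distance
    -- bound pays for the rounding up here and for the positions inside the cells.
    set n := ⌈(i + b) / (8 * δ)⌉₊ with hn
    have hn1 : (i + b) / (8 * δ) ≤ n := Nat.le_ceil _
    have hn2 : (n : ℝ) < (i + b) / (8 * δ) + 1 := Nat.ceil_lt_add_one (by positivity)
    rw [div_le_iff₀' (by positivity)] at hn1
    set J := ((Finset.range n).image fun k => e (m + 1 + k)).filter (· ∈ Int.floor '' S) with hJ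
    have hcard : (J.card : ℝ) = ∑ k ∈ Finset.range n, cellIndicator S (e (m + 1 + k)) := by
      rw [hJ, Finset.card_filter, Finset.sum_image (by intro a _ b _ h; simpa using he h)]
      push_cast
      exact Finset.sum_congr rfl fun k _ => by simp [cellIndicator, Set.indicator_apply]
    refine nnDist_le_of_finset J ?_ ?_
    · have := hcount n
      rw [← hcard] at this
      have : (i : ℝ) ≤ J.card := by linarith
      exact_mod_cast this
    · intro j hj
      rw [hJ, Finset.mem_filter, Finset.mem_image] at hj
      obtain ⟨⟨k, hk, rfl⟩, y, hy, hyj⟩ := hj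
      refine ⟨y, hy, hyj, ?_, ?_⟩
      -- The cell of `x` is `e m`, and only cells from `e (m + 1)` on are used.
      · rintro rfl
        have := he (hem.symm.trans hyj)
        omega
      · rw [edist_dist, Real.dist_eq]
        refine ENNReal.ofReal_le_ofReal ?_
        have h1 := abs_le.1 (hdist (k + 1))
        rw [← hem, ← add_assoc, add_right_comm, ← hyj] at h1
        have hkn : (k : ℝ) + 1 ≤ n := by exact_mod_cast Finset.mem_range.1 hk
        have h2 : -((k : ℝ) + 1) ≤ ⌊x⌋ - ⌊y⌋ := by exact_mod_cast h1.1
        have h3 : (⌊x⌋ : ℝ) - ⌊y⌋ ≤ (k : ℝ) + 1 := by exact_mod_cast h1.2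
        have := Int.floor_le x
        have := Int.floor_le y
        have := Int.lt_floor_add_one x
        have := Int.lt_floor_add_one y
        have h4 : (i + b) / (8 * δ) = 1 / (8 * δ) * i + b / (8 * δ) := by ring
        rw [abs_le]
        constructor <;> linarith
  refine (range_le_of_nnDist_le hα (by positivity) (by positivity) hnn).trans
    (ENNReal.ofReal_le_ofReal (le_of_eq ?_))
  rw [hb]
  field_simp
  ring

/-- No edge of the graph joins the points below `t` to the other points. -/
def IsCut (α : ℕ+ → ℝ≥0) (S : Set ℝ) (t : ℝ) : Prop :=
  ∀ x ∈ S, ∀ y ∈ S, x < t → t ≤ y → range α S x < edist x y ∧ range α S y < edist x y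

lemma isCut_of_goodGap {α : ℕ+ → ℝ≥0} (hα : ∀ i : ℕ+, α i ≤ (1 / 2) ^ (i : ℕ)) {S : Set ℝ}
    {δ C : ℝ} (hδ : 0 < δ) (hC : 0 ≤ C) {c : ℤ} {L : ℕ}
    (hL : (1 + 2 * C) / (4 * δ) + 5 ≤ L)
    (h : ∀ N, GoodGap (9 * δ) δ C (cellIndicator S) c L N) : IsCut α S c := by
  intro x hx y hy hxc hcy
  obtain ⟨m, hm⟩ : ∃ m : ℕ, ⌊x⌋ = c - 1 - m := by
    have : ⌊x⌋ < c := Int.floor_lt.2 hxc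
    exact ⟨(c - 1 - ⌊x⌋).toNat, by omega⟩
  -- The gap is empty, so a point to the right of `c` lies beyond the whole gap.
  have hyL : c + L ≤ ⌊y⌋ := by
    have hcy' : c ≤ ⌊y⌋ := Int.le_floor.2 hcy
    by_contra! hlt
    have := (h 0).2.1 (⌊y⌋ - c).toNat (by omega)
    rw [show c + ((⌊y⌋ - c).toNat : ℤ) = ⌊y⌋ by omega, cellIndicator,
      Set.indicator_of_mem (Set.mem_image_of_mem _ hy)] at this
    simp at this
  obtain ⟨l, hl⟩ : ∃ l : ℕ, ⌊y⌋ = c + L + l := ⟨(⌊y⌋ - (c + L)).toNat, by omega⟩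
  have hmR : (⌊x⌋ : ℝ) = c - 1 - m := by exact_mod_cast hm
  have hlR : (⌊y⌋ : ℝ) = c + L + l := by exact_mod_cast hl
  have hx1 := Int.lt_floor_add_one x
  have hy1 := Int.floor_le y
  have hd : edist x y = ENNReal.ofReal (y - x) := by
    rw [edist_dist, Real.dist_eq, abs_sub_comm, abs_of_pos (by linarith)]
  have hm0 : (0 : ℝ) ≤ m := by positivity
  have hl0 : (0 : ℝ) ≤ l := by positivity
  rw [hd]
  constructor
  -- The path leads away from the gap. By the choice of `L` the range is at most `(m + 1) / 2 + L -
  -- 1`, while `y - x > m + L + l`.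
  · refine (range_le_of_deviationBound hα hδ hC (e := fun k => c - 1 - k) (m := m)
      (fun a b h => by simpa using h) hm (fun k => ?_) fun N => (h N).1).trans_lt ?_
    · push_cast; rw [abs_le]; constructor <;> omega
    · rw [ENNReal.ofReal_lt_ofReal_iff (by linarith)]
      linarith
  · refine (range_le_of_deviationBound hα hδ hC (e := fun k => c + L + k) (m := l)
      (fun a b h => by simpa using h) hl (fun k => ?_) fun N => (h N).2.2).trans_lt ?_
    · push_cast; rw [abs_le]; constructor <;> omega
    · rw [ENNReal.ofReal_lt_ofReal_iff (by linarith)]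
      linarith

lemma IsCut.lt_iff_of_adj {α : ℕ+ → ℝ≥0} {S : Set ℝ} {t : ℝ} (h : IsCut α S t) {x y : S}
    (hxy : (graph α S).Adj x y) : (x : ℝ) < t ↔ (y : ℝ) < t := by
  have key : ∀ u v : S, (graph α S).Adj u v → (u : ℝ) < t → (v : ℝ) < t := by
    intro u v huv hu
    by_contra! hv
    have := h u u.2 v v.2 hu hv
    rw [graph, SimpleGraph.fromRel_adj] at huv
    rcases huv.2 with h1 | h1
    · exact absurd h1 (not_le.2 this.1)
    · rw [edist_comm] at h1
      exact absurd h1 (not_le.2 this.2)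
  exact ⟨key x y hxy, key y x hxy.symm⟩

lemma IsCut.lt_iff_of_reachable {α : ℕ+ → ℝ≥0} {S : Set ℝ} {t : ℝ} (h : IsCut α S t) {x y : S}
    (hxy : (graph α S).Reachable x y) : (x : ℝ) < t ↔ (y : ℝ) < t := by
  obtain ⟨w⟩ := hxy
  induction w with
  | nil => rfl
  | cons hadj _ ih => exact (h.lt_iff_of_adj hadj).trans ih

theorem not_hasInfiniteCluster_of_isCut {α : ℕ+ → ℝ≥0} {S : Set ℝ}
    (hfin : ∀ n : ℕ, (S ∩ Set.Icc (-n : ℝ) n).Finite)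
    (hr : ∀ K : ℕ, ∃ t : ℝ, K ≤ t ∧ IsCut α S t) (hl : ∀ K : ℕ, ∃ t : ℝ, t ≤ -K ∧ IsCut α S t) :
    ¬ HasInfiniteCluster α S := by
  rintro ⟨comp, hinf⟩
  obtain ⟨v, rfl⟩ := comp.exists_rep
  obtain ⟨K, hK⟩ := exists_nat_gt |(v : ℝ)|
  obtain ⟨h1, h2⟩ := abs_lt.1 hK
  obtain ⟨t, ht, htc⟩ := hr K
  obtain ⟨s, hs, hsc⟩ := hl K
  obtain ⟨n, hn⟩ := exists_nat_ge (max t (-s))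
  have hn1 := (le_max_left _ _).trans hn
  have hn2 := (le_max_right _ _).trans hn
  refine hinf (((hfin n).preimage Subtype.val_injective.injOn).subset fun w hw => ?_)
  have hreach : (graph α S).Reachable v w :=
    (SimpleGraph.ConnectedComponent.exact ((SimpleGraph.ConnectedComponent.mem_supp_iff _ _).1 hw)).symm
  have hwt := (htc.lt_iff_of_reachable hreach).1 (by linarith)
  have hws := (not_congr (hsc.lt_iff_of_reachable hreach)).1 (by linarith)
  exact ⟨w.2, by linarith, by linarith⟩

end GNModel

/-! ### Occupied cells of a Poisson process -/

namespace IsPoissonProcess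

open GNModel

variable {Ω : Type*} [MeasurableSpace Ω] {P : Measure Ω}

lemma measure_count_eq {E : Type*} [MeasurableSpace E] {ν : Measure E} {X : Ω → Set E}
    (hX : IsPoissonProcess P ν X) {B : Set E} (hB : MeasurableSet B) (hν : ν B < ∞) (A : Set ℕ∞) :
    P {ω | (X ω ∩ B).encard ∈ A} =
      poissonMeasure (ν B).toNNReal ((fun n : ℕ => (n : ℕ∞)) ⁻¹' A) := by
  have hA : MeasurableSet A := MeasurableSet.of_discrete
  rw [← Measure.map_apply (measurable_of_countable _) hA, ← hX.map_count B hB hν,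
    Measure.map_apply (hX.measurable_count B hB hν) hA]
  rfl

lemma ae_finite {E : Type*} [MeasurableSpace E] {ν : Measure E} {X : Ω → Set E}
    (hX : IsPoissonProcess P ν X) {B : Set E} (hB : MeasurableSet B) (hν : ν B < ∞) :
    ∀ᵐ ω ∂P, (X ω ∩ B).Finite := by
  have h := hX.measure_count_eq hB hν {⊤}
  have h0 : (fun n : ℕ => (n : ℕ∞)) ⁻¹' {⊤} = ∅ := by ext n; simp
  rw [h0, measure_empty] at h
  rw [ae_iff, ← h]
  congr 1
  ext ω
  exact Set.encard_eq_top_iff.symm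

lemma measure_count_eq_pos {E : Type*} [MeasurableSpace E] {ν : Measure E} {X : Ω → Set E}
    (hX : IsPoissonProcess P ν X) {B : Set E} (hB : MeasurableSet B) (hν : ν B < ∞)
    (hpos : 0 < ν B) (n : ℕ) : 0 < P {ω | (X ω ∩ B).encard = n} := by
  have h := hX.measure_count_eq hB hν {(n : ℕ∞)}
  have h0 : (fun n : ℕ => (n : ℕ∞)) ⁻¹' {(n : ℕ∞)} = {n} := by ext k; simp
  rw [h0] at h
  change P {ω | (X ω ∩ B).encard = n} = _ at h
  rw [h]
  exact (ENNReal.toReal_pos_iff.1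
    (poissonMeasure_real_singleton_pos n (ENNReal.toNNReal_pos hpos.ne' hν.ne))).1

lemma iIndepFun_count {E : Type*} [MeasurableSpace E] {ν : Measure E} {X : Ω → Set E}
    (hX : IsPoissonProcess P ν X) {ι : Type*} {B : ι → Set E} (hB : ∀ i, MeasurableSet (B i))
    (hν : ∀ i, ν (B i) < ∞) (hd : Pairwise fun i j => Disjoint (B i) (B j)) :
    iIndepFun (fun i ω => (X ω ∩ B i).encard) P := by
  rw [iIndepFun_iff_finset]
  intro s
  have h := hX.indep_count s.card (fun k => B (s.equivFin.symm k)) (fun _ => hB _)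
    (fun _ => hν _) fun i j hij => hd fun h => hij (s.equivFin.symm.injective (Subtype.ext h))
  have h' := h.precomp s.equivFin.injective
  simp only [Equiv.symm_apply_apply] at h'
  exact h'

/-- The map sending the number of points in a cell to its occupation indicator. -/
noncomputable def occupation (n : ℕ∞) : ℝ := if n = 0 then 0 else 1

lemma cellIndicator_eq_occupation (S : Set ℝ) (j : ℤ) :
    cellIndicator S j = occupation (S ∩ Set.Ico (j : ℝ) (j + 1)).encard := by
  have : j ∈ Int.floor '' S ↔ (S ∩ Set.Ico (j : ℝ) (j + 1)).Nonempty := by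
    simp only [Set.mem_image, Int.floor_eq_iff]
    rfl
  by_cases h : (S ∩ Set.Ico (j : ℝ) (j + 1)).Nonempty
  · rw [cellIndicator, Set.indicator_of_mem (this.2 h), occupation,
      if_neg (Set.encard_ne_zero.2 h)]
    rfl
  · rw [cellIndicator, Set.indicator_of_notMem (mt this.1 h), occupation,
      if_pos (Set.encard_eq_zero.2 (Set.not_nonempty_iff_eq_empty.1 h))]

theorem ae_not_hasInfiniteCluster [IsProbabilityMeasure P] {lam : ℝ≥0} (hlam : 0 < lam)
    {X : Ω → Set ℝ} (hX : IsPoissonProcess P (lam • (volume : Measure ℝ)) X) {α : ℕ+ → ℝ≥0}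
    (hα : ∀ i : ℕ+, α i ≤ (1 / 2) ^ (i : ℕ)) : ∀ᵐ ω ∂P, ¬ HasInfiniteCluster α (X ω) := by
  set B : ℤ → Set ℝ := fun j => Set.Ico (j : ℝ) (j + 1) with hBdef
  have hB : ∀ j, MeasurableSet (B j) := fun j => measurableSet_Ico
  have hvol : ∀ j, (lam • (volume : Measure ℝ)) (B j) = lam := fun j => by
    rw [Measure.smul_apply, ENNReal.smul_def, hBdef, Real.volume_Ico]
    simp
  have hν : ∀ j, (lam • (volume : Measure ℝ)) (B j) < ∞ := fun j => by
    rw [hvol]; exact ENNReal.coe_lt_top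
  have hpos : ∀ j, 0 < (lam • (volume : Measure ℝ)) (B j) := fun j => by
    rw [hvol]; exact_mod_cast hlam
  have hocc : Measurable occupation := measurable_of_countable _
  set Z : ℤ → Ω → ℝ := fun j ω => cellIndicator (X ω) j with hZdef
  have hZ : ∀ j, Z j = fun ω => occupation (X ω ∩ B j).encard := fun j => by
    funext ω; exact cellIndicator_eq_occupation _ _
  have hmeas : ∀ j, Measurable (Z j) := fun j => by
    rw [hZ]; exact hocc.comp (hX.measurable_count _ (hB j) (hν j))
  have hind : iIndepFun Z P := by
    have hd : Pairwise fun i j => Disjoint (B i) (B j) := by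
      exact Set.pairwise_disjoint_Ico_intCast ℝ
    have := (hX.iIndepFun_count hB hν hd).comp (fun _ => occupation) fun _ => hocc
    exact (funext hZ : Z = fun j ω => occupation (X ω ∩ B j).encard) ▸ this
  have hid : ∀ j, IdentDistrib (Z j) (Z 0) P P := fun j => by
    rw [hZ, hZ]
    refine IdentDistrib.comp (u := occupation) ⟨(hX.measurable_count _ (hB j) (hν j)).aemeasurable,
      (hX.measurable_count _ (hB 0) (hν 0)).aemeasurable, ?_⟩ hocc
    rw [hX.map_count _ (hB j) (hν j), hX.map_count _ (hB 0) (hν 0), hvol, hvol]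
  have hZ01 : ∀ j ω, Z j ω = 0 ∨ Z j ω = 1 := fun j ω => by
    rw [hZ]; by_cases h : (X ω ∩ B j).encard = 0 <;> simp [occupation, h]
  have hint : Integrable (Z 0) P :=
    Integrable.of_bound (hmeas 0).aestronglyMeasurable 1 (Filter.Eventually.of_forall fun ω => by
      rcases hZ01 0 ω with h | h <;> simp [h])
  have h0 : 0 < P {ω | Z 0 ω = 0} := by
    refine (hX.measure_count_eq_pos (hB 0) (hν 0) (hpos 0) 0).trans_le
      (measure_mono fun ω (hω : _ = _) => ?_)
    change Z 0 ω = 0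
    rw [hZ]
    simp [occupation, hω]
  have hq : 0 < ∫ ω, Z 0 ω ∂P := by
    rw [integral_pos_iff_support_of_nonneg (fun ω => by
      rcases hZ01 0 ω with h | h <;> simp [h]) hint]
    refine (hX.measure_count_eq_pos (hB 0) (hν 0) (hpos 0) 1).trans_le
      (measure_mono fun ω (hω : _ = _) => ?_)
    change Z 0 ω ≠ 0
    rw [hZ]
    simp [occupation, hω]
  obtain ⟨δ, hqδ⟩ : ∃ δ, ∫ ω, Z 0 ω ∂P = 9 * δ := ⟨(∫ ω, Z 0 ω ∂P) / 9, by ring⟩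
  have hδ : 0 < δ := by linarith
  obtain ⟨C, hC, hgap⟩ := ae_exists_goodGap hmeas hind hid hint h0 hδ
  have hg : Function.Injective (fun j : ℤ => -1 - j) := fun a b h => by simpa using h
  have hid' : ∀ j, IdentDistrib (Z j) (Z (-1)) P P := fun j => (hid j).trans (hid _).symm
  -- Applied to the reflected cells `-1 - j`, the same theorem yields the gaps on the negative side.
  obtain ⟨C', hC', hgap'⟩ := ae_exists_goodGap (Z := fun j => Z (-1 - j)) (fun j => hmeas _)
    (hind.precomp hg) (fun j => hid' _) ((hid _).integrable_iff.2 hint)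
    (by
      have h := (hid (-1 - 0)).measure_mem_eq (measurableSet_singleton (0 : ℝ))
      exact h0.trans_eq h.symm) hδ
  rw [(hid (-1 - 0)).integral_eq, hqδ] at hgap'
  rw [hqδ] at hgap
  -- The length may depend on `C`, because `ae_exists_goodGap` provides `C` before `L`.
  obtain ⟨L, hL⟩ := exists_nat_ge ((1 + 2 * C) / (4 * δ) + 5)
  obtain ⟨L', hL'⟩ := exists_nat_ge ((1 + 2 * C') / (4 * δ) + 5)
  have hfin : ∀ᵐ ω ∂P, ∀ n : ℕ, (X ω ∩ Set.Icc (-n : ℝ) n).Finite := by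
    rw [ae_all_iff]
    refine fun n => hX.ae_finite measurableSet_Icc ?_
    rw [Measure.smul_apply, ENNReal.smul_def, Real.volume_Icc]
    exact ENNReal.mul_lt_top ENNReal.coe_lt_top ENNReal.ofReal_lt_top
  filter_upwards [hfin, hgap L, hgap' L'] with ω h1 h2 h3
  refine not_hasInfiniteCluster_of_isCut h1 (fun K => ?_) fun K => ?_
  · obtain ⟨c, hKc, hc⟩ := h2 K
    exact ⟨c, by exact_mod_cast hKc, isCut_of_goodGap hα hδ hC hL hc⟩
  · obtain ⟨c, hKc, hc⟩ := h3 K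
    refine ⟨((-c - L' : ℤ) : ℝ), ?_, isCut_of_goodGap hα hδ hC' hL' fun N => ?_⟩
    · have : -c - (L' : ℤ) ≤ -(K : ℤ) := by omega
      exact_mod_cast this
    · exact GoodGap.reflect (z := fun j => Z j ω) (hc N)

end IsPoissonProcess

theorem mainTheorem5 {Ω : Type*} [MeasurableSpace Ω] (P : Measure Ω) [IsProbabilityMeasure P]
    (lam : ℝ≥0) (hlam : 0 < lam) (X : Ω → Set ℝ)
    (hX : IsPoissonProcess P (lam • (volume : Measure ℝ)) X)
    (γ : ℝ≥0) (hγ0 : 0 < γ) (hγ : γ ≤ 1 / 2) :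
    (∀ᵐ ω ∂P, ¬ GNModel.HasInfiniteCluster (fun i : ℕ+ => γ ^ (i : ℕ)) (X ω)) ∧
    (∀ α : ℕ+ → ℝ≥0, (∀ i : ℕ+, α i ≤ γ ^ (i : ℕ)) →
      ∀ᵐ ω ∂P, ¬ GNModel.HasInfiniteCluster α (X ω)) := by
  have hpow : ∀ i : ℕ+, γ ^ (i : ℕ) ≤ (1 / 2) ^ (i : ℕ) := fun i => pow_le_pow_left' hγ _
  exact ⟨hX.ae_not_hasInfiniteCluster hlam hpow,
    fun α hα => hX.ae_not_hasInfiniteCluster hlam fun i => (hα i).trans (hpow i)⟩
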